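/- **Theorem B (standard harmonic cycle decomposition).** Let $G$ be a finite connected graph, with loops and multiple edges allowed, and fix a reference orientation of its edges. Let $\partial_1$ be the incidence matrix of $G$ (rows indexed by vertices, columns by edges; the column of an edge is its head minus its tail, hence zero for a loop), and let $Z_1(G)=\ker\partial_1\subset\mathbb{Z}^{E(G)}$. Let $\partial$ be an integer matrix with rows indexed by $E(G)$ such that $\ker\partial=0$, $\partial_1\partial=0$ and $\operatorname{rk}(\ker\partial_1/\operatorname{im}\partial)=1$; the pair $\mathscr{A}=(G,\partial)$ is called a unicyclization. Let $\beta$ be a basis of $Z_1(G)$ and let $w_{\mathscr{A}}(z)=\det([z]_\beta,[\partial]_\beta)$ for $z\in Z_1(G)$, where $[\,\cdot\,]_\beta$ denotes coordinates with respect to $\beta$, taken column by column for $\partial$. Let $\mathcal{U}(G)$ be the set of cycletrees of $G$, i.e. of connected spanning subgraphs of $G$ with exactly one cycle. For $Y\in\mathcal{U}(G)$ with unique cycle $C_Y$, choose an orientation of $C_Y$ and let $z_Y\in Z_1(G)$ be the corresponding element, with coefficients $\pm1$ on the edges of $C_Y$ and $0$ on all other edges. Then, for every choice of $\beta$ and of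 these orientations, the standard harmonic cycle $$\lambda_{\mathscr{A}}=\sum_{Y\in\mathcal{U}(G)}w_{\mathscr{A}}(z_Y)\,z_Y$$ is a non-zero harmonic cycle: $\lambda_{\mathscr{A}}\neq0$ and $\Delta_1\lambda_{\mathscr{A}}=0$ for the combinatorial Laplacian $\Delta_1=\partial_1^t\partial_1+\partial\partial^t$ on $\mathbb{R}^{E(G)}$; moreover $\lambda_{\mathscr{A}}\in\ker\partial_1\cap\ker\partial^t$. -/

import Mathlib

namespace Graph

variable {α β : Type*}

/-- `G` has a vertex, and any two vertices are joined by a walk in `G`. -/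
def IsConnectedGraph (G : Graph α β) : Prop :=
  G.vertexSet.Nonempty ∧
    ∀ x ∈ G.vertexSet, ∀ y ∈ G.vertexSet, Relation.ReflTransGen G.Adj x y

/-- `C` is a cycle graph: distinct vertices `v 0, …, v n` and distinct edges `e 0, …, e n`, with
`e i` joining `v i` to `v (i + 1)`, indices modulo `n + 1`. A loop (`n = 0`) and a pair of parallel
edges (`n = 1`) are cycles. -/
def IsCycleGraph (C : Graph α β) : Prop :=
  ∃ (n : ℕ) (v : Fin (n + 1) → α) (e : Fin (n + 1) → β),
    Function.Injective v ∧ Function.Injective e ∧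
    (∀ i, C.IsLink (e i) (v i) (v (i + 1))) ∧
    C.vertexSet = Set.range v ∧ C.edgeSet = Set.range e

/-- A cycletree in `G`: a connected spanning subgraph of `G` with exactly one cycle. -/
structure IsCycletree (G Y : Graph α β) : Prop where
  spanning : Y.IsSpanningSubgraph G
  connected : Y.IsConnectedGraph
  existsUnique_cycle : ∃! C : Graph α β, C ≤ Y ∧ C.IsCycleGraph

/-- The collection `𝒰(G)` of all cycletrees in `G`. -/
def Cycletree (G : Graph α β) : Type _ := {Y : Graph α β // IsCycletree G Y}

namespace Cycletree

variable {G : Graph α β}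

/-- The unique cycle `C_Y` of a cycletree `Y`. -/
noncomputable def cycle (Y : Cycletree G) : Graph α β := Y.2.existsUnique_cycle.choose

lemma cycle_le (Y : Cycletree G) : Y.cycle ≤ Y.1 := Y.2.existsUnique_cycle.choose_spec.1.1

lemma isCycleGraph_cycle (Y : Cycletree G) : Y.cycle.IsCycleGraph :=
  Y.2.existsUnique_cycle.choose_spec.1.2

lemma cycle_le_graph (Y : Cycletree G) : Y.cycle ≤ G :=
  Y.cycle_le.trans Y.2.spanning.le

end Cycletree

/-- A finite graph has finitely many cycletrees. -/
instance finite_cycletree (G : Graph α β) [Finite G.edgeSet] : Finite (Cycletree G) := by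
  refine Finite.of_injective
    (fun Y : Cycletree G => {e : G.edgeSet | (e : β) ∈ Y.1.edgeSet}) ?_
  intro Y Y' h
  have hle := Y.2.spanning.le
  have hle' := Y'.2.spanning.le
  refine Subtype.ext (Compatible.ext ?_ ?_ (Compatible.of_le_le hle hle'))
  · rw [Y.2.spanning.vertexSet_eq, Y'.2.spanning.vertexSet_eq]
  · ext e
    constructor
    · intro he
      exact (Set.ext_iff.1 h ⟨e, hle.edgeSet_mono he⟩).1 he
    · intro he
      exact (Set.ext_iff.1 h ⟨e, hle'.edgeSet_mono he⟩).2 he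

noncomputable instance fintypeCycletree (G : Graph α β) [Finite G.edgeSet] :
    Fintype (Cycletree G) := Fintype.ofFinite _

/-- A reference orientation of the edges, giving the generators `[e]` of the chain group. -/
structure EdgeOrientation (G : Graph α β) where
  tail : G.edgeSet → G.vertexSet
  head : G.edgeSet → G.vertexSet
  isLink : ∀ e : G.edgeSet, G.IsLink (e : β) (tail e) (head e)

namespace EdgeOrientation

variable {G : Graph α β} (D : G.EdgeOrientation)

open Classical in
/-- The incidence matrix `∂₁`, with rows indexed by vertices and columns by edges. -/
noncomputable def incidence : Matrix G.vertexSet G.edgeSet ℤ :=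
  Matrix.of fun v e => (if D.head e = v then 1 else 0) - (if D.tail e = v then 1 else 0)

variable [Fintype G.edgeSet]

/-- The cycle space `Z₁(G) = ker ∂₁`, with integer coefficients. -/
noncomputable def cycleSpace : Submodule ℤ (G.edgeSet → ℤ) :=
  LinearMap.ker D.incidence.mulVecLin

/-- `z ∈ Z₁(G)` is an element corresponding to the cycle `C`, for one of the two orientations of
`C`: its coefficients are `±1` on the edges of `C` and `0` elsewhere. -/
def Represents (z : D.cycleSpace) (C : Graph α β) : Prop :=
  (∀ e : G.edgeSet, (e : β) ∈ C.edgeSet →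
    (z : G.edgeSet → ℤ) e = 1 ∨ (z : G.edgeSet → ℤ) e = -1) ∧
  ∀ e : G.edgeSet, (e : β) ∉ C.edgeSet → (z : G.edgeSet → ℤ) e = 0

/-- Every cycle in `G` is represented by an element of `Z₁(G)`. -/
lemma exists_represents {C : Graph α β} (hCG : C ≤ G) (hC : C.IsCycleGraph) :
    ∃ z : D.cycleSpace, D.Represents z C := by
  classical
  obtain ⟨n, v, e, -, he, hl, -, hE⟩ := hC
  have heG : ∀ i, e i ∈ G.edgeSet := fun i => hCG.edgeSet_mono (hl i).edge_mem
  let s : Fin (n + 1) → ℤ := fun i =>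
    if (D.tail ⟨e i, heG i⟩ : α) = v i ∧ (D.head ⟨e i, heG i⟩ : α) = v (i + 1) then 1 else -1
  let z : G.edgeSet → ℤ := fun f => ∑ i, if (⟨e i, heG i⟩ : G.edgeSet) = f then s i else 0
  have hz : z ∈ D.cycleSpace := by
    rw [cycleSpace, LinearMap.mem_ker]
    ext u
    have key : ∀ i, D.incidence u ⟨e i, heG i⟩ * s i =
        (if v (i + 1) = (u : α) then 1 else 0) - (if v i = (u : α) then 1 else 0) := by
      intro i
      have h1 := (D.isLink ⟨e i, heG i⟩).eq_and_eq_or_eq_and_eq ((hl i).mono hCG)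
      simp only [incidence, Matrix.of_apply, s, Subtype.ext_iff]
      rcases h1 with ⟨ht, hh⟩ | ⟨ht, hh⟩
      · simp [ht, hh]
      · by_cases hv : v i = v (i + 1)
        · simp [ht, hh, hv]
        · simp [ht, hh, Ne.symm hv]
    have hsum : (D.incidence.mulVec z) u = ∑ i, D.incidence u ⟨e i, heG i⟩ * s i := by
      simp only [Matrix.mulVec, dotProduct, z, Finset.mul_sum]
      rw [Finset.sum_comm]
      refine Finset.sum_congr rfl fun i _ => ?_
      simp
    have hshift : ∑ i : Fin (n + 1), (if v (i + 1) = (u : α) then (1 : ℤ) else 0) =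
        ∑ i : Fin (n + 1), (if v i = (u : α) then (1 : ℤ) else 0) :=
      Equiv.sum_comp (Equiv.addRight (1 : Fin (n + 1)))
        (fun i => if v i = (u : α) then (1 : ℤ) else 0)
    rw [Matrix.mulVecLin_apply, hsum, Finset.sum_congr rfl fun i _ => key i,
      Finset.sum_sub_distrib, hshift, sub_self]
    rfl
  refine ⟨⟨z, hz⟩, ?_, ?_⟩
  · intro f hf
    rw [hE] at hf
    obtain ⟨i, hi⟩ := hf
    have hzi : z f = s i := by
      have : ∀ j, ((⟨e j, heG j⟩ : G.edgeSet) = f) ↔ j = i := by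
        intro j
        rw [Subtype.ext_iff, ← hi]
        exact he.eq_iff
      simp [z, this]
    change z f = 1 ∨ z f = -1
    rw [hzi]
    by_cases h : (D.tail ⟨e i, heG i⟩ : α) = v i ∧ (D.head ⟨e i, heG i⟩ : α) = v (i + 1)
    · exact Or.inl (if_pos h)
    · exact Or.inr (if_neg h)
  · intro f hf
    change z f = 0
    refine Finset.sum_eq_zero fun i _ => if_neg fun h => hf ?_
    rw [← h]
    exact (hl i).edge_mem

/-- A choice, for every cycletree `Y`, of an orientation of its cycle `C_Y`, given by the
corresponding element `z_Y ∈ Z₁(G)`. -/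
structure CycleChoice where
  z : Cycletree G → D.cycleSpace
  represents : ∀ Y, D.Represents (z Y) Y.cycle

instance : Nonempty D.CycleChoice :=
  ⟨⟨fun Y => (D.exists_represents Y.cycle_le_graph Y.isCycleGraph_cycle).choose,
    fun Y => (D.exists_represents Y.cycle_le_graph Y.isCycleGraph_cycle).choose_spec⟩⟩

/-- `H₁ = ker ∂₁ / im ∂`, with integer coefficients. -/
abbrev H1 {r : ℕ} (bd : Matrix G.edgeSet (Fin r) ℤ) : Type _ :=
  D.cycleSpace ⧸ (LinearMap.range bd.mulVecLin).submoduleOf D.cycleSpace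

/-- `bd` is a unicyclizer of `G`: an integer matrix `∂` with `ker ∂ = 0`, `∂₁ ∂ = 0` and
`rk (ker ∂₁ / im ∂) = 1`. -/
structure IsUnicyclizer {r : ℕ} (bd : Matrix G.edgeSet (Fin r) ℤ) : Prop where
  ker_eq_bot : LinearMap.ker bd.mulVecLin = ⊥
  incidence_mul : D.incidence * bd = 0
  rank_H1 : Module.finrank ℤ (D.H1 bd) = 1

namespace IsUnicyclizer

variable {D} {r : ℕ} {bd : Matrix G.edgeSet (Fin r) ℤ}

/-- The columns of `∂`, as elements of `Z₁(G)`. -/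
def column (h : D.IsUnicyclizer bd) (j : Fin r) : D.cycleSpace :=
  ⟨bd.col j, by
    rw [cycleSpace, LinearMap.mem_ker, Matrix.mulVecLin_apply]
    ext v
    exact congrFun (congrFun h.incidence_mul v) j⟩

/-- `Z₁(G)` is free of rank `r + 1`, so it has bases indexed by `Fin (r + 1)`, and only these are
needed for the winding number. -/
lemma finrank_cycleSpace (h : D.IsUnicyclizer bd) :
    Module.finrank ℤ D.cycleSpace = r + 1 := by
  have hle : LinearMap.range bd.mulVecLin ≤ D.cycleSpace := by
    rintro _ ⟨x, rfl⟩
    rw [cycleSpace, LinearMap.mem_ker, Matrix.mulVecLin_apply, Matrix.mulVecLin_apply,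
      Matrix.mulVec_mulVec, h.incidence_mul, Matrix.zero_mulVec]
  have h1 := Submodule.finrank_quotient_add_finrank
    ((LinearMap.range bd.mulVecLin).submoduleOf D.cycleSpace)
  have h2 : Module.finrank ℤ ((LinearMap.range bd.mulVecLin).submoduleOf D.cycleSpace) = r := by
    rw [(Submodule.submoduleOfEquivOfLe hle).finrank_eq,
      LinearMap.finrank_range_of_inj (LinearMap.ker_eq_bot.1 h.ker_eq_bot)]
    simp
  have h3 := h.rank_H1
  unfold H1 at h3
  omega

lemma nonempty_basis (h : D.IsUnicyclizer bd) :
    Nonempty (Module.Basis (Fin (r + 1)) ℤ D.cycleSpace) :=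
  ⟨Module.finBasisOfFinrankEq ℤ D.cycleSpace h.finrank_cycleSpace⟩

/-- The winding number `w(z) = det ([z]_b, [∂]_b)` relative to a basis `b` of `Z₁(G)`. -/
noncomputable def winding (h : D.IsUnicyclizer bd)
    (b : Module.Basis (Fin (r + 1)) ℤ D.cycleSpace) (z : D.cycleSpace) : ℤ :=
  (b.toMatrix (Fin.cons z h.column)).det

/-- The standard harmonic cycle `∑_Y w(z_Y) z_Y`, the sum over all cycletrees `Y` in `G`. -/
noncomputable def standardHarmonicCycle (h : D.IsUnicyclizer bd)
    (b : Module.Basis (Fin (r + 1)) ℤ D.cycleSpace) (c : D.CycleChoice) : D.cycleSpace :=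
  ∑ Y : Cycletree G, h.winding b (c.z Y) • c.z Y

end IsUnicyclizer

variable [Fintype G.vertexSet]

/-- The combinatorial Laplacian `Δ₁ = ∂₁ᵗ ∂₁ + ∂ ∂ᵗ` with real coefficients. -/
noncomputable def laplacian {r : ℕ} (bd : Matrix G.edgeSet (Fin r) ℤ) :
    Matrix G.edgeSet G.edgeSet ℝ :=
  let d₁ := D.incidence.map (Int.cast : ℤ → ℝ)
  let d₂ := bd.map (Int.cast : ℤ → ℝ)
  d₁.transpose * d₁ + d₂ * d₂.transpose

/-- The space of harmonic cycles, `ker Δ₁`. -/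
noncomputable def harmonicSpace {r : ℕ} (bd : Matrix G.edgeSet (Fin r) ℤ) :
    Submodule ℝ (G.edgeSet → ℝ) :=
  LinearMap.ker (D.laplacian bd).mulVecLin

end EdgeOrientation

end Graph

/-! Write `⟨·,·⟩` for the standard pairing on edge chains, `w` for the winding number and `τ` for
the number of spanning trees. Everything follows from `⟨λ, x⟩ = τ · w(x)` for all cycles `x`
(`sum_standardHarmonicCycle_mul`). A column of `∂` repeats inside the determinant, so `w` kills it
and `∂ᵗ λ = 0`; `∂₁ λ = 0` holds since `λ` is a combination of cycles. As `w ≠ 0`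
(`exists_winding_ne_zero`) and `τ > 0` (`exists_isSpanningTree`), also `λ ≠ 0`.

The formula is `w` applied to `∑_Y ⟨z_Y, x⟩ z_Y = τ x` (`CycleChoice.sum_smul`). Expand the left
side over pairs `(Y, e)` with `e` on `C_Y`. Deleting `e` matches them with pairs `(T, e)`, `T` a
spanning tree and `e ∉ T`. Since `z_Y(e) = ±1`, the term `z_Y(e) x(e) z_Y` is `x(e)` times the
fundamental cycle of `e` for `T`, whatever the orientation of `C_Y`. For fixed `T` these terms add
up to `x`. -/

namespace Graph

/-! ### Walks, cycles and spanning subgraphs. -/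

section Cycles

variable {α β : Type*}

/-- Two vertices joined by a walk are joined by a walk without repeated vertices. -/
lemma exists_path_of_reflTransGen {R : α → α → Prop} {x y : α} (h : Relation.ReflTransGen R x y) :
    ∃ (n : ℕ) (v : ℕ → α), v 0 = x ∧ v n = y ∧ (∀ i < n, R (v i) (v (i + 1))) ∧
      Set.InjOn v (Set.Iic n) := by
  classical
  have hex : ∃ (n : ℕ) (v : ℕ → α), v 0 = x ∧ v n = y ∧ ∀ i < n, R (v i) (v (i + 1)) := by
    induction h with
    | refl => exact ⟨0, fun _ => x, rfl, rfl, by simp⟩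
    | @tail b c _ hbc ih =>
      obtain ⟨n, v, h0, hn, hs⟩ := ih
      refine ⟨n + 1, fun i => if i ≤ n then v i else c, by simp [h0], by simp, fun i hi => ?_⟩
      rcases (Nat.lt_succ_iff.1 hi).lt_or_eq with hlt | rfl
      · simpa [hlt.le, Nat.succ_le_iff.2 hlt] using hs i hlt
      · simpa [hn] using hbc
  obtain ⟨v, h0, hn, hs⟩ := Nat.find_spec hex
  refine ⟨Nat.find hex, v, h0, hn, hs, ?_⟩
  have key : ∀ i j, i < j → j ≤ Nat.find hex → v i ≠ v j := by
    intro i j hij hj hv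
    -- In a shortest walk, a repetition `v i = v j` would allow the steps from `i` to `j` to be cut
    -- out.
    refine Nat.find_min hex (m := Nat.find hex - (j - i)) (by omega)
      ⟨fun k => if k ≤ i then v k else v (k + (j - i)), by simp [h0], ?_, fun k hk => ?_⟩
    · by_cases hle : Nat.find hex - (j - i) ≤ i
      · have h1 : Nat.find hex = j := by omega
        have h2 : Nat.find hex - (j - i) = i := by omega
        simp only [h2, le_refl, if_true]
        rw [hv, ← hn, ← h1]
      · simp only [hle, if_false]
        rw [Nat.sub_add_cancel (by omega), hn]
    · rcases lt_trichotomy k i with hki | rfl | hki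
      · simpa [hki.le, Nat.succ_le_iff.2 hki] using hs k (by omega)
      · have h1 := hs j (by omega)
        have h2 : k + 1 + (j - k) = j + 1 := by omega
        simpa [h2, hv] using h1
      · have h1 := hs (k + (j - i)) (by omega)
        have h2 : k + 1 + (j - i) = k + (j - i) + 1 := by omega
        simpa [hki.not_ge, (show ¬ k + 1 ≤ i by omega), h2] using h1
  intro i hi j hj hv
  rcases lt_trichotomy i j with h | h | h
  · exact absurd hv (key i j h hj)
  · exact h
  · exact absurd hv.symm (key j i h hi)

/-- An edge whose ends are joined by a walk avoiding it lies on a cycle. -/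
lemma exists_isCycleGraph_of_reflTransGen {G K : Graph α β} {e : β} {x y : α}
    (he : G.IsLink e x y) (hK : K ≤ G) (heK : e ∉ K.edgeSet)
    (h : Relation.ReflTransGen K.Adj y x) :
    ∃ C ≤ G, C.IsCycleGraph ∧ e ∈ C.edgeSet ∧ C.edgeSet ⊆ insert e K.edgeSet := by
  obtain ⟨n, v, h0, hn, hs, hinj⟩ := exists_path_of_reflTransGen h
  have : Nonempty β := ⟨e⟩
  choose! f hf using hs
  let w : Fin (n + 1) → α := fun i => v i
  -- The last index carries `e`, which closes the path from `v n = x` back to `v 0 = y`; for `n = 0`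
  -- it is a loop.
  let g : Fin (n + 1) → β := fun i => if (i : ℕ) < n then f i else e
  have hw : Function.Injective w := fun i j hij =>
    Fin.ext (hinj (Nat.lt_succ_iff.1 i.2) (Nat.lt_succ_iff.1 j.2) hij)
  have hgl : ∀ i, G.IsLink (g i) (w i) (w (i + 1)) := by
    intro i
    by_cases hi : (i : ℕ) < n
    · have h1 : ((i + 1 : Fin (n + 1)) : ℕ) = i + 1 :=
        Fin.val_add_one_of_lt (Fin.lt_def.2 (by simpa using hi))
      simpa [g, w, hi, h1] using (hf i hi).mono hK
    · have h1 : i = Fin.last n := Fin.ext (by simp; omega)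
      subst h1
      simpa [g, w, hn, h0] using he
  have hg : Function.Injective g := by
    intro i j hij
    have hne : ∀ k : Fin (n + 1), (k : ℕ) < n → f k ≠ e := fun k hk hke =>
      heK (hke ▸ (hf k hk).edge_mem)
    by_cases hi : (i : ℕ) < n <;> by_cases hj : (j : ℕ) < n
    · simp only [g, hi, hj, if_true] at hij
      have hli := hf i hi
      rw [hij] at hli
      have hin : ∀ k ≤ n, k ∈ Set.Iic n := fun k hk => hk
      -- Equal edges have equal ends; the crossed matching would force `i = j + 1` and `j = i + 1`.
      rcases hli.eq_and_eq_or_eq_and_eq (hf j hj) with ⟨h1, -⟩ | ⟨h1, h2⟩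
      · exact Fin.ext (hinj (hin _ hi.le) (hin _ hj.le) h1)
      · have h3 := hinj (hin _ hi.le) (hin _ hj) h1
        have h4 := hinj (hin _ hi) (hin _ hj.le) h2
        omega
    · simp only [g, hi, hj, if_true, if_false] at hij
      exact absurd hij (hne i hi)
    · simp only [g, hi, hj, if_true, if_false] at hij
      exact absurd hij.symm (hne j hj)
    · exact Fin.ext (by omega)
  let C : Graph α β := (G.restrict (Set.range g)).induce (Set.range w)
  have hCl : ∀ i, C.IsLink (g i) (w i) (w (i + 1)) := fun i => by
    simp [C, hgl i]
  have hCE : C.edgeSet = Set.range g := by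
    ext k
    constructor
    · intro hk
      obtain ⟨a, b, hab⟩ := exists_isLink_of_mem_edgeSet hk
      simp only [C, induce_isLink, restrict_isLink] at hab
      tauto
    · rintro ⟨i, rfl⟩
      exact (hCl i).edge_mem
  refine ⟨C, (induce_le ?_).trans restrict_le, ⟨n, w, g, hw, hg, hCl, rfl, hCE⟩, ?_, ?_⟩
  · rintro _ ⟨i, rfl⟩
    exact (hgl i).left_mem
  · rw [hCE]
    exact ⟨Fin.last n, by simp [g]⟩
  · rw [hCE]
    rintro _ ⟨i, rfl⟩
    by_cases hi : (i : ℕ) < n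
    · simp only [g, hi, if_true]
      exact Or.inr (hf i hi).edge_mem
    · simp [g, hi]

lemma IsCycleGraph.edgeSet_nonempty {C : Graph α β} (hC : C.IsCycleGraph) :
    C.edgeSet.Nonempty := by
  obtain ⟨n, v, e, -, -, hl, -, -⟩ := hC
  exact ⟨e 0, (hl 0).edge_mem⟩

lemma IsCycleGraph.mem_vertexSet_iff {C : Graph α β} (hC : C.IsCycleGraph) {x : α} :
    x ∈ C.vertexSet ↔ ∃ e ∈ C.edgeSet, C.Inc e x := by
  obtain ⟨n, v, e, -, -, hl, hV, -⟩ := hC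
  constructor
  · rw [hV]
    rintro ⟨i, rfl⟩
    exact ⟨e i, (hl i).edge_mem, (hl i).inc_left⟩
  · rintro ⟨e, -, h⟩
    exact h.vertex_mem

/-- A cycle in a graph is determined by its edges. -/
lemma IsCycleGraph.eq_of_edgeSet_eq {G C C' : Graph α β} (hC : C.IsCycleGraph)
    (hC' : C'.IsCycleGraph) (hCG : C ≤ G) (hCG' : C' ≤ G) (h : C.edgeSet = C'.edgeSet) :
    C = C' := by
  refine Compatible.ext ?_ h (Compatible.of_le_le hCG hCG')
  ext x
  rw [hC.mem_vertexSet_iff, hC'.mem_vertexSet_iff, ← h]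
  refine exists_congr fun e => and_congr_right fun he => ?_
  rw [hCG.inc_congr he, hCG'.inc_congr (h ▸ he)]

lemma reflTransGen_adj_symm {G : Graph α β} {x y : α} (h : Relation.ReflTransGen G.Adj x y) :
    Relation.ReflTransGen G.Adj y x := by
  induction h with
  | refl => exact .refl
  | tail _ hbc ih => exact .head hbc.symm ih

/-- Connectedness passes to a spanning subgraph that joins the ends of every edge. -/
lemma IsConnectedGraph.of_isLink {G H : Graph α β} (hG : G.IsConnectedGraph)
    (hV : H.vertexSet = G.vertexSet)
    (h : ∀ e x y, G.IsLink e x y → Relation.ReflTransGen H.Adj x y) : H.IsConnectedGraph := by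
  refine ⟨hV ▸ hG.1, fun x hx y hy => ?_⟩
  have hxy := hG.2 x (hV ▸ hx) y (hV ▸ hy)
  clear hx hy
  induction hxy with
  | refl => exact .refl
  | tail _ hbc ih =>
    obtain ⟨e, he⟩ := hbc
    exact ih.trans (h e _ _ he)

/-- The spanning subgraph with edge set `T`. -/
def spanningSubgraph (G : Graph α β) (T : Finset G.edgeSet) : Graph α β :=
  G.restrict ((↑) '' (T : Set G.edgeSet))

variable {G : Graph α β} {T S : Finset G.edgeSet}

lemma isSpanningSubgraph_spanningSubgraph : (G.spanningSubgraph T).IsSpanningSubgraph G :=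
  ⟨restrict_le, rfl⟩

lemma spanningSubgraph_le : G.spanningSubgraph T ≤ G := restrict_le

lemma mem_edgeSet_spanningSubgraph {f : G.edgeSet} :
    (f : β) ∈ (G.spanningSubgraph T).edgeSet ↔ f ∈ T := by
  simp [spanningSubgraph]

lemma spanningSubgraph_isLink {e : G.edgeSet} {x y : α} :
    (G.spanningSubgraph T).IsLink e x y ↔ e ∈ T ∧ G.IsLink e x y := by
  simp [spanningSubgraph, and_comm]

lemma spanningSubgraph_mono (h : T ⊆ S) : G.spanningSubgraph T ≤ G.spanningSubgraph S :=
  restrict_mono_right _ (Set.image_mono (by exact_mod_cast h))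

lemma eq_spanningSubgraph {Y : Graph α β} (hY : Y.IsSpanningSubgraph G)
    (h : ∀ f : G.edgeSet, (f : β) ∈ Y.edgeSet ↔ f ∈ T) : Y = G.spanningSubgraph T := by
  refine Compatible.ext hY.vertexSet_eq ?_ (Compatible.of_le_le hY.le spanningSubgraph_le)
  ext e
  constructor
  · intro he
    exact (mem_edgeSet_spanningSubgraph (f := ⟨e, hY.le.edgeSet_mono he⟩)).2 ((h _).1 he)
  · intro he
    exact (h ⟨e, spanningSubgraph_le.edgeSet_mono he⟩).2 (mem_edgeSet_spanningSubgraph.1 he)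

/-- Deleting an edge whose ends remain joined preserves connectedness. -/
lemma IsConnectedGraph.spanningSubgraph_erase [DecidableEq G.edgeSet] {f : G.edgeSet} {x y : α}
    (h : (G.spanningSubgraph T).IsConnectedGraph) (hf : G.IsLink f x y)
    (hxy : Relation.ReflTransGen (G.spanningSubgraph (T.erase f)).Adj x y) :
    (G.spanningSubgraph (T.erase f)).IsConnectedGraph := by
  refine h.of_isLink rfl fun e a b hab => ?_
  have he : e ∈ G.edgeSet := (hab.mono spanningSubgraph_le).edge_mem
  lift e to G.edgeSet using he
  rw [spanningSubgraph_isLink] at hab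
  by_cases hef : e = f
  · subst hef
    rcases hab.2.eq_and_eq_or_eq_and_eq hf with ⟨rfl, rfl⟩ | ⟨rfl, rfl⟩
    · exact hxy
    · exact reflTransGen_adj_symm hxy
  · exact .single ⟨e, spanningSubgraph_isLink.2 ⟨Finset.mem_erase.2 ⟨hef, hab.1⟩, hab.2⟩⟩

end Cycles

end Graph

/-! ### Spanning trees, fundamental cycles and the sum over cycletrees. -/

namespace Graph

namespace EdgeOrientation

variable {α β : Type*} {G : Graph α β} (D : G.EdgeOrientation)

lemma sum_mul_incidence_eq_zero [Fintype G.edgeSet] (z : D.cycleSpace) (u : G.vertexSet) :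
    ∑ g, D.incidence u g * (z : G.edgeSet → ℤ) g = 0 := by
  have h : D.incidence.mulVec (z : G.edgeSet → ℤ) = 0 := LinearMap.mem_ker.1 z.2
  exact congrFun h u

/-- If `z f ≠ 0` for a cycle `z`, then the ends of `f` are joined by the other edges in the
support of `z`. -/
lemma reflTransGen_of_ne_zero [Fintype G.vertexSet] [Fintype G.edgeSet] (z : D.cycleSpace)
    {f : G.edgeSet} (hf : (z : G.edgeSet → ℤ) f ≠ 0) {T : Finset G.edgeSet}
    (hT : ∀ g, g ≠ f → (z : G.edgeSet → ℤ) g ≠ 0 → g ∈ T) :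
    Relation.ReflTransGen (G.spanningSubgraph T).Adj (D.head f) (D.tail f) := by
  classical
  by_contra hcon
  -- Cut argument: sum `∂₁ z = 0` over the vertices `U` reachable from the head of `f`. Only edges
  -- leaving or entering `U` contribute, and in the support of `z` that is `f` alone, so `z f = 0`.
  let U : Finset G.vertexSet := Finset.univ.filter fun u =>
    Relation.ReflTransGen (G.spanningSubgraph T).Adj (D.head f) u
  have hU : ∀ u, u ∈ U ↔ Relation.ReflTransGen (G.spanningSubgraph T).Adj (D.head f) u := by
    simp [U]
  have hcol : ∀ g, ∑ u ∈ U, D.incidence u g =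
      (if D.head g ∈ U then 1 else 0) - (if D.tail g ∈ U then 1 else 0) := by
    intro g
    simp [incidence, Finset.sum_sub_distrib, Finset.sum_ite_eq]
  have h0 : ∑ g, (∑ u ∈ U, D.incidence u g) * (z : G.edgeSet → ℤ) g = 0 := by
    simp_rw [Finset.sum_mul]
    rw [Finset.sum_comm]
    exact Finset.sum_eq_zero fun u _ => D.sum_mul_incidence_eq_zero z u
  rw [Finset.sum_eq_single f, hcol] at h0
  · rw [if_pos ((hU _).2 .refl), if_neg (mt (hU _).1 hcon)] at h0
    simp_all
  · intro g _ hgf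
    by_cases hg : (z : G.edgeSet → ℤ) g = 0
    · simp [hg]
    · have hl : (G.spanningSubgraph T).IsLink g (D.tail g) (D.head g) :=
        spanningSubgraph_isLink.2 ⟨hT g hgf hg, D.isLink g⟩
      have hiff : D.head g ∈ U ↔ D.tail g ∈ U := by
        rw [hU, hU]
        exact ⟨fun h => h.tail ⟨g, hl.symm⟩, fun h => h.tail ⟨g, hl⟩⟩
      rw [hcol]
      simp [hiff]
  · simp

variable [Fintype G.edgeSet]

/-- `T` is the edge set of a spanning tree: it spans a connected subgraph and supports no nonzero
element of the cycle space. -/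
structure IsSpanningTree (T : Finset G.edgeSet) : Prop where
  connected : (G.spanningSubgraph T).IsConnectedGraph
  eq_zero : ∀ z : D.cycleSpace, (∀ f ∉ T, (z : G.edgeSet → ℤ) f = 0) → z = 0

variable {D} {T : Finset G.edgeSet} {e : G.edgeSet}

lemma Represents.ne_zero_iff {z : D.cycleSpace} {C : Graph α β} (h : D.Represents z C)
    {f : G.edgeSet} : (z : G.edgeSet → ℤ) f ≠ 0 ↔ (f : β) ∈ C.edgeSet := by
  constructor
  · intro hf
    by_contra hC
    exact hf (h.2 f hC)
  · intro hC
    rcases h.1 f hC with h | h <;> simp [h]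

lemma Represents.ne_zero {z : D.cycleSpace} {C : Graph α β} (h : D.Represents z C)
    (hC : C.IsCycleGraph) (hCG : C ≤ G) : z ≠ 0 := by
  obtain ⟨e, he⟩ := hC.edgeSet_nonempty
  rintro rfl
  exact (h.ne_zero_iff (f := ⟨e, hCG.edgeSet_mono he⟩)).2 he rfl

lemma Represents.apply_eq_zero {z : D.cycleSpace} {C : Graph α β} (h : D.Represents z C)
    {S : Finset G.edgeSet} (hC : C ≤ G.spanningSubgraph S) :
    ∀ f ∉ S, (z : G.edgeSet → ℤ) f = 0 := fun f hf =>
  h.2 f fun hfC => hf (mem_edgeSet_spanningSubgraph.1 (hC.edgeSet_mono hfC))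

variable [DecidableEq G.edgeSet]

lemma IsSpanningTree.apply_ne_zero (hT : D.IsSpanningTree T) {z : D.cycleSpace} (hz : z ≠ 0)
    (hzT : ∀ f ∉ insert e T, (z : G.edgeSet → ℤ) f = 0) : (z : G.edgeSet → ℤ) e ≠ 0 := by
  intro he
  refine hz (hT.eq_zero z fun f hf => ?_)
  by_cases hfe : f = e
  · rw [hfe, he]
  · exact hzT f (by simp [hfe, hf])

/-- The cycle space elements supported on a spanning tree and one more edge `e` are determined by
their coefficient at `e`. -/
lemma IsSpanningTree.smul_eq_smul (hT : D.IsSpanningTree T) {z z' : D.cycleSpace}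
    (hz : ∀ f ∉ insert e T, (z : G.edgeSet → ℤ) f = 0)
    (hz' : ∀ f ∉ insert e T, (z' : G.edgeSet → ℤ) f = 0) :
    (z' : G.edgeSet → ℤ) e • z = (z : G.edgeSet → ℤ) e • z' := by
  rw [← sub_eq_zero]
  refine hT.eq_zero _ fun f hf => ?_
  by_cases hfe : f = e
  · subst hfe
    simp [mul_comm]
  · have h : f ∉ insert e T := by simp [hfe, hf]
    simp [hz f h, hz' f h]

/-- Adding an edge to a spanning tree gives a cycletree. -/
lemma IsSpanningTree.isCycletree_insert (hT : D.IsSpanningTree T) (he : e ∉ T) :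
    IsCycletree G (G.spanningSubgraph (insert e T)) := by
  have hle : G.spanningSubgraph T ≤ G.spanningSubgraph (insert e T) :=
    spanningSubgraph_mono (Finset.subset_insert e T)
  refine ⟨isSpanningSubgraph_spanningSubgraph, ?_, ?_⟩
  · refine ⟨hT.connected.1, fun x hx y hy => ?_⟩
    exact Relation.ReflTransGen.mono (fun _ _ h => h.mono hle) _ _ (hT.connected.2 x hx y hy)
  · obtain ⟨C, hC, hCc, -, -⟩ := exists_isCycleGraph_of_reflTransGen
      (spanningSubgraph_isLink.2 ⟨Finset.mem_insert_self e T, D.isLink e⟩) hle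
      (mt mem_edgeSet_spanningSubgraph.1 he)
      (hT.connected.2 _ (D.head e).2 _ (D.tail e).2)
    refine ⟨C, ⟨hC, hCc⟩, fun C' ⟨hC', hCc'⟩ => ?_⟩
    have hCG := hC.trans spanningSubgraph_le
    have hCG' := hC'.trans spanningSubgraph_le
    obtain ⟨z, hz⟩ := D.exists_represents hCG hCc
    obtain ⟨z', hz'⟩ := D.exists_represents hCG' hCc'
    have hs := hz.apply_eq_zero hC
    have hs' := hz'.apply_eq_zero hC'
    have h1 := hT.apply_ne_zero (hz.ne_zero hCc hCG) hs
    have h2 := hT.apply_ne_zero (hz'.ne_zero hCc' hCG') hs'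
    -- Both cycles pass through `e`, so their chains are proportional with non-zero factors and have
    -- the same support.
    have h3 := hT.smul_eq_smul hs hs'
    refine hCc'.eq_of_edgeSet_eq hCc hCG' hCG ?_
    have h4 : ∀ f : G.edgeSet, (f : β) ∈ C'.edgeSet ↔ (f : β) ∈ C.edgeSet := by
      intro f
      rw [← hz.ne_zero_iff, ← hz'.ne_zero_iff]
      have h5 := congrArg (fun y : D.cycleSpace => (y : G.edgeSet → ℤ) f) h3
      simp only [Submodule.coe_smul, Pi.smul_apply, smul_eq_mul] at h5
      refine not_congr ⟨fun h => ?_, fun h => ?_⟩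
      · simpa [h, h2] using h5
      · simpa [h, h1] using h5.symm
    ext f
    exact ⟨fun hf => (h4 ⟨f, hCG'.edgeSet_mono hf⟩).1 hf,
      fun hf => (h4 ⟨f, hCG.edgeSet_mono hf⟩).2 hf⟩

variable (D) in
/-- The element of the cycle space supported on `T` and `e` with coefficient `1` at `e`. -/
noncomputable def fundamentalCycle (T : Finset G.edgeSet) (e : G.edgeSet) : D.cycleSpace :=
  Classical.epsilon fun z : D.cycleSpace => (z : G.edgeSet → ℤ) e = 1 ∧
    ∀ f ∉ insert e T, (z : G.edgeSet → ℤ) f = 0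

/-- The unique cycle of `T` with `e` added must pass through `e`, with coefficient `±1`; a change of
sign makes it `1`. -/
lemma IsSpanningTree.fundamentalCycle_spec (hT : D.IsSpanningTree T) (he : e ∉ T) :
    (D.fundamentalCycle T e : G.edgeSet → ℤ) e = 1 ∧
      ∀ f ∉ insert e T, (D.fundamentalCycle T e : G.edgeSet → ℤ) f = 0 := by
  refine Classical.epsilon_spec (p := fun z : D.cycleSpace => (z : G.edgeSet → ℤ) e = 1 ∧
    ∀ f ∉ insert e T, (z : G.edgeSet → ℤ) f = 0) ?_
  obtain ⟨C, ⟨hC, hCc⟩, -⟩ := (hT.isCycletree_insert he).existsUnique_cycle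
  have hCG := hC.trans spanningSubgraph_le
  obtain ⟨z, hz⟩ := D.exists_represents hCG hCc
  have hs := hz.apply_eq_zero hC
  have h1 := hT.apply_ne_zero (hz.ne_zero hCc hCG) hs
  rcases hz.1 e (hz.ne_zero_iff.1 h1) with h | h
  · exact ⟨z, h, hs⟩
  · exact ⟨-z, by simp [h], fun f hf => by simpa using hs f hf⟩

/-- The expansion of a cycle in the fundamental cycles of a spanning tree. -/
lemma IsSpanningTree.sum_fundamentalCycle (hT : D.IsSpanningTree T) (x : D.cycleSpace) :
    ∑ e ∈ Tᶜ, (x : G.edgeSet → ℤ) e • D.fundamentalCycle T e = x := by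
  rw [eq_comm, ← sub_eq_zero]
  -- It suffices to compare coefficients off `T`; at `f ∉ T` only the fundamental cycle of `f`
  -- contributes.
  refine hT.eq_zero _ fun f hf => ?_
  simp only [AddSubgroupClass.coe_sub, Submodule.coe_sum, Submodule.coe_smul, Pi.sub_apply,
    Finset.sum_apply, Pi.smul_apply, smul_eq_mul]
  rw [Finset.sum_eq_single f, (hT.fundamentalCycle_spec hf).1, mul_one, sub_self]
  · intro e he hef
    rw [(hT.fundamentalCycle_spec (Finset.mem_compl.1 he)).2 f (by simp [hef.symm, hf]), mul_zero]
  · intro h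
    exact absurd (Finset.mem_compl.2 hf) h

variable [Fintype G.vertexSet]

/-- If the edges `T` contain no cycle, they support no nonzero element of the cycle space. -/
lemma eq_zero_of_forall_not_isCycleGraph (h : ∀ C ≤ G.spanningSubgraph T, ¬ C.IsCycleGraph)
    (z : D.cycleSpace) (hz : ∀ f ∉ T, (z : G.edgeSet → ℤ) f = 0) : z = 0 := by
  by_contra hne
  have hex : ∃ f, (z : G.edgeSet → ℤ) f ≠ 0 := by
    by_contra! hcon
    exact hne (Subtype.ext (funext hcon))
  obtain ⟨f, hf⟩ := hex
  have hfT : f ∈ T := by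
    by_contra hfT
    exact hf (hz f hfT)
  -- The ends of a support edge `f` are joined by the rest of the support, and `f` closes this up to
  -- a cycle.
  obtain ⟨C, hC, hCc, -, -⟩ := exists_isCycleGraph_of_reflTransGen
    (spanningSubgraph_isLink.2 ⟨hfT, D.isLink f⟩) (spanningSubgraph_mono (T.erase_subset f))
    (fun hm => Finset.notMem_erase f T (mem_edgeSet_spanningSubgraph.1 hm))
    (D.reflTransGen_of_ne_zero z hf (T := T.erase f) fun g hgf hg =>
      Finset.mem_erase.2 ⟨hgf, by by_contra hgT; exact hg (hz g hgT)⟩)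
  exact h C hC hCc

/-- Removing an edge of its cycle from a cycletree gives a spanning tree. -/
lemma isSpanningTree_erase (hY : IsCycletree G (G.spanningSubgraph T)) {C : Graph α β}
    (hC : C ≤ G.spanningSubgraph T) (hCc : C.IsCycleGraph) (he : (e : β) ∈ C.edgeSet) :
    D.IsSpanningTree (T.erase e) := by
  have hCG := hC.trans spanningSubgraph_le
  obtain ⟨z, hz⟩ := D.exists_represents hCG hCc
  have hs := hz.apply_eq_zero hC
  refine ⟨hY.connected.spanningSubgraph_erase (D.isLink e).symm
    (D.reflTransGen_of_ne_zero z (hz.ne_zero_iff.2 he) fun g hge hg =>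
      Finset.mem_erase.2 ⟨hge, by by_contra hgT; exact hg (hs g hgT)⟩),
    eq_zero_of_forall_not_isCycleGraph fun C' hC' hCc' => ?_⟩
  have h := hY.existsUnique_cycle.unique ⟨hC, hCc⟩
    ⟨hC'.trans (spanningSubgraph_mono (T.erase_subset e)), hCc'⟩
  subst h
  exact Finset.notMem_erase e T (mem_edgeSet_spanningSubgraph.1 (hC'.edgeSet_mono he))

/-- A connected graph has a spanning tree. -/
lemma exists_isSpanningTree (hG : G.IsConnectedGraph) : ∃ T, D.IsSpanningTree T := by
  have huniv : (G.spanningSubgraph Finset.univ).IsConnectedGraph := by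
    rwa [← eq_spanningSubgraph (Y := G) .rfl (by simp)]
  obtain ⟨T, hT⟩ := Set.Finite.exists_minimal
    (s := {T : Finset G.edgeSet | (G.spanningSubgraph T).IsConnectedGraph})
    (Set.toFinite _) ⟨_, huniv⟩
  refine ⟨T, hT.prop, fun z hz => ?_⟩
  by_contra hne
  have hex : ∃ f, (z : G.edgeSet → ℤ) f ≠ 0 := by
    by_contra! hcon
    exact hne (Subtype.ext (funext hcon))
  obtain ⟨f, hf⟩ := hex
  have hfT : f ∈ T := by
    by_contra hfT
    exact hf (hz f hfT)
  -- An edge in the support of a cycle could be deleted, against the minimality of `T` among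
  -- connected edge sets.
  have h : (G.spanningSubgraph (T.erase f)).IsConnectedGraph :=
    IsConnectedGraph.spanningSubgraph_erase hT.prop (D.isLink f).symm
      (D.reflTransGen_of_ne_zero z hf fun g hgf hg =>
        Finset.mem_erase.2 ⟨hgf, by by_contra hgT; exact hg (hz g hgT)⟩)
  exact Finset.notMem_erase f T (hT.le_of_le h (T.erase_subset f) hfT)

open Classical in
/-- Summing the rank one operators of the cycles of all cycletrees multiplies a cycle by the number
of spanning trees. -/
theorem CycleChoice.sum_smul (c : D.CycleChoice) (x : D.cycleSpace) :
    ∑ Y : Cycletree G, (∑ e, (c.z Y : G.edgeSet → ℤ) e * (x : G.edgeSet → ℤ) e) • c.z Y =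
      ((Finset.univ.filter D.IsSpanningTree).card : ℤ) • x := by
  have hl : ∑ Y : Cycletree G, (∑ e, (c.z Y : G.edgeSet → ℤ) e * (x : G.edgeSet → ℤ) e) • c.z Y =
      ∑ q : Cycletree G × G.edgeSet with (c.z q.1 : G.edgeSet → ℤ) q.2 ≠ 0,
        ((c.z q.1 : G.edgeSet → ℤ) q.2 * (x : G.edgeSet → ℤ) q.2) • c.z q.1 := by
    simp_rw [Finset.sum_smul]
    rw [← Fintype.sum_prod_type' (f := fun Y e =>
      ((c.z Y : G.edgeSet → ℤ) e * (x : G.edgeSet → ℤ) e) • c.z Y)]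
    rw [Finset.sum_filter_of_ne]
    intro q _ hq h0
    rw [h0, zero_mul, zero_smul] at hq
    exact hq rfl
  have hr : ((Finset.univ.filter D.IsSpanningTree).card : ℤ) • x =
      ∑ p : Finset G.edgeSet × G.edgeSet with D.IsSpanningTree p.1 ∧ p.2 ∉ p.1,
        (x : G.edgeSet → ℤ) p.2 • D.fundamentalCycle p.1 p.2 := by
    rw [Nat.cast_smul_eq_nsmul, ← Finset.sum_const, Finset.sum_filter, Finset.sum_filter,
      Fintype.sum_prod_type]
    refine Finset.sum_congr rfl fun T _ => ?_
    by_cases hT : D.IsSpanningTree T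
    · simp only [hT, if_true, true_and]
      rw [← Finset.sum_filter, ← hT.sum_fundamentalCycle x]
      refine Finset.sum_congr (by ext; simp) fun e _ => ?_
      rw [hT.sum_fundamentalCycle x]
    · simp [hT]
  rw [hl, hr]
  let E : Cycletree G → Finset G.edgeSet := fun Y =>
    Finset.univ.filter fun f => (f : β) ∈ Y.1.edgeSet
  have hE : ∀ Y : Cycletree G, Y.1 = G.spanningSubgraph (E Y) := fun Y =>
    eq_spanningSubgraph Y.2.spanning (by simp [E])
  have hmem : ∀ (Y : Cycletree G) (e : G.edgeSet), (c.z Y : G.edgeSet → ℤ) e ≠ 0 → e ∈ E Y := by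
    intro Y e he
    simpa [E] using Y.cycle_le.edgeSet_mono ((c.represents Y).ne_zero_iff.1 he)
  have htree : ∀ (Y : Cycletree G) (e : G.edgeSet), (c.z Y : G.edgeSet → ℤ) e ≠ 0 →
      D.IsSpanningTree ((E Y).erase e) := by
    intro Y e he
    exact isSpanningTree_erase (hE Y ▸ Y.2) (C := Y.cycle) (hE Y ▸ Y.cycle_le)
      Y.isCycleGraph_cycle ((c.represents Y).ne_zero_iff.1 he)
  have hsupp : ∀ Y : Cycletree G, ∀ f ∉ E Y, (c.z Y : G.edgeSet → ℤ) f = 0 := fun Y f hf => by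
    by_contra h
    exact hf (hmem Y f h)
  -- The bijection `(Y, e) ↦ (Y - e, e)`, with inverse `(T, e) ↦ (T + e, e)`.
  refine Finset.sum_bij (fun q _ => ((E q.1).erase q.2, q.2)) ?_ ?_ ?_ ?_
  · rintro ⟨Y, e⟩ hq
    simp only [Finset.mem_filter, Finset.mem_univ, true_and] at hq ⊢
    exact ⟨htree Y e hq, Finset.notMem_erase _ _⟩
  · rintro ⟨Y, e⟩ hq ⟨Y', e'⟩ hq' h
    simp only [Finset.mem_filter, Finset.mem_univ, true_and] at hq hq'
    simp only [Prod.mk.injEq] at h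
    obtain ⟨h, rfl⟩ := h
    have h1 : E Y = E Y' := by
      rw [← Finset.insert_erase (hmem Y e hq), h, Finset.insert_erase (hmem Y' e hq')]
    have h2 : Y = Y' := Subtype.ext (by rw [hE Y, hE Y', h1])
    rw [h2]
  · rintro ⟨T, e⟩ hp
    simp only [Finset.mem_filter, Finset.mem_univ, true_and] at hp
    obtain ⟨hT, he⟩ := hp
    let Y : Cycletree G := ⟨_, hT.isCycletree_insert he⟩
    have hEY : E Y = insert e T := by
      ext f
      rw [← mem_edgeSet_spanningSubgraph (T := insert e T)]
      simp only [E, Finset.mem_filter, Finset.mem_univ, true_and, Y]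
    have hne : (c.z Y : G.edgeSet → ℤ) e ≠ 0 :=
      hT.apply_ne_zero ((c.represents Y).ne_zero Y.isCycleGraph_cycle Y.cycle_le_graph)
        (hEY ▸ hsupp Y)
    refine ⟨(Y, e), by simpa using hne, ?_⟩
    simp only [hEY, Finset.erase_insert he]
  · rintro ⟨Y, e⟩ hq
    simp only [Finset.mem_filter, Finset.mem_univ, true_and] at hq ⊢
    have hT := htree Y e hq
    obtain ⟨h1, h2⟩ := hT.fundamentalCycle_spec (Finset.notMem_erase e (E Y))
    have h3 := hT.smul_eq_smul (e := e) (z := c.z Y) (by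
      rw [Finset.insert_erase (hmem Y e hq)]
      exact hsupp Y) h2
    rw [h1, one_smul] at h3
    -- Here `z_Y` is its coefficient `k = ±1` at `e` times the fundamental cycle. The term holds `k`
    -- twice, so the sign cancels.
    have h4 : (c.z Y : G.edgeSet → ℤ) e * (c.z Y : G.edgeSet → ℤ) e = 1 := by
      rcases (c.represents Y).1 e ((c.represents Y).ne_zero_iff.1 hq) with h | h <;> simp [h]
    set k := (c.z Y : G.edgeSet → ℤ) e with hk
    rw [h3, smul_smul, mul_right_comm, h4, one_mul]

end EdgeOrientation

end Graph

/-! ### The winding number and harmonicity. -/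

namespace Graph

namespace EdgeOrientation

namespace IsUnicyclizer

variable {α β : Type*} {G : Graph α β} [Fintype G.edgeSet] {D : G.EdgeOrientation} {r : ℕ}
  {bd : Matrix G.edgeSet (Fin r) ℤ} (h : D.IsUnicyclizer bd)
  (b : Module.Basis (Fin (r + 1)) ℤ D.cycleSpace)

/-- The winding number as a linear form on the cycle space. -/
noncomputable def windingHom : D.cycleSpace →ₗ[ℤ] ℤ where
  toFun := h.winding b
  map_add' x y := by
    simp only [winding, ← Module.Basis.det_apply]
    exact b.det.map_vecCons_add h.column x y
  map_smul' a x := by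
    simp only [winding, ← Module.Basis.det_apply]
    exact b.det.map_vecCons_smul h.column a x

lemma windingHom_apply (z : D.cycleSpace) : h.windingHom b z = h.winding b z := rfl

lemma winding_column (j : Fin r) : h.winding b (h.column j) = 0 := by
  rw [winding, ← Module.Basis.det_apply]
  exact b.det.map_eq_zero_of_eq _ (i := 0) (j := j.succ) (by simp) (Fin.succ_ne_zero j).symm

lemma sum_smul_column (v : Fin r → ℤ) :
    ((∑ j, v j • h.column j : D.cycleSpace) : G.edgeSet → ℤ) = bd.mulVec v := by
  ext e
  simp [column, Matrix.mulVec, dotProduct, mul_comm]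

/-- The winding number is not identically zero, since `H₁` is not torsion. -/
lemma exists_winding_ne_zero : ∃ z, h.winding b z ≠ 0 := by
  have h1 : Module.finrank ℤ (D.H1 bd) ≠ 0 := by simp [h.rank_H1]
  rw [ne_eq, Module.finrank_eq_zero_iff] at h1
  push Not at h1
  obtain ⟨q, hq⟩ := h1
  obtain ⟨z, rfl⟩ := Submodule.Quotient.mk_surjective _ q
  refine ⟨z, fun hw => ?_⟩
  -- Let `z` represent a non-torsion class. A zero determinant gives a non-trivial integer relation
  -- between `z` and the columns of `∂`; its coefficient at `z` vanishes as the class is not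
  -- torsion, the others because `∂` is injective.
  obtain ⟨v, hv, hv0⟩ := Matrix.exists_mulVec_eq_zero_iff.2 hw
  have h2 : ∑ j, v j • (Fin.cons z h.column : Fin (r + 1) → D.cycleSpace) j = 0 := by
    refine b.repr.injective (Finsupp.ext fun i => ?_)
    have h3 := congrFun hv0 i
    simp only [Matrix.mulVec, dotProduct, Module.Basis.toMatrix_apply, Pi.zero_apply] at h3
    simp only [map_sum, map_smul, Finsupp.coe_finsetSum, Finset.sum_apply, Finsupp.smul_apply,
      smul_eq_mul, map_zero, Finsupp.coe_zero, Pi.zero_apply]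
    rw [← h3]
    exact Finset.sum_congr rfl fun j _ => mul_comm _ _
  rw [Fin.sum_univ_succ] at h2
  simp only [Fin.cons_zero, Fin.cons_succ] at h2
  have h3 : v 0 = 0 := by
    by_contra h0
    refine hq (v 0) h0 ?_
    rw [← Submodule.Quotient.mk_smul, Submodule.Quotient.mk_eq_zero, Submodule.submoduleOf,
      Submodule.mem_comap]
    refine ⟨-fun j => v j.succ, ?_⟩
    rw [Matrix.mulVecLin_apply, Matrix.mulVec_neg, ← h.sum_smul_column,
      eq_neg_of_add_eq_zero_left h2]
    rfl
  rw [h3, zero_smul, zero_add] at h2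
  have h4 : (fun j : Fin r => v j.succ) = 0 := by
    have h5 : (fun j : Fin r => v j.succ) ∈ LinearMap.ker bd.mulVecLin := by
      rw [LinearMap.mem_ker, Matrix.mulVecLin_apply, ← h.sum_smul_column, h2]
      rfl
    rwa [h.ker_eq_bot, Submodule.mem_bot] at h5
  refine hv (funext fun j => ?_)
  cases j using Fin.cases with
  | zero => exact h3
  | succ j => exact congrFun h4 j

variable [Fintype G.vertexSet]

open Classical in
/-- Pairing with the standard harmonic cycle is the winding number times the number of spanning
trees. -/
theorem sum_standardHarmonicCycle_mul (c : D.CycleChoice) (x : D.cycleSpace) :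
    ∑ e, (h.standardHarmonicCycle b c : G.edgeSet → ℤ) e * (x : G.edgeSet → ℤ) e =
      (Finset.univ.filter D.IsSpanningTree).card * h.winding b x := by
  have h1 := congrArg (h.windingHom b) (c.sum_smul x)
  simp only [map_sum, map_smul, smul_eq_mul, windingHom_apply] at h1
  rw [← h1]
  simp only [standardHarmonicCycle, Submodule.coe_sum, Submodule.coe_smul, Finset.sum_apply,
    Pi.smul_apply, smul_eq_mul, Finset.sum_mul]
  rw [Finset.sum_comm]
  exact Finset.sum_congr rfl fun Y _ => Finset.sum_congr rfl fun e _ => by ring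

end IsUnicyclizer

lemma map_intCast_mulVec_eq_zero {m n : Type*} [Fintype n] {A : Matrix m n ℤ} {z : n → ℤ}
    (h : A.mulVec z = 0) :
    (A.map (Int.cast : ℤ → ℝ)).mulVec (fun e => ((z e : ℤ) : ℝ)) = 0 := by
  ext i
  have hi := congrArg (Int.cast : ℤ → ℝ) (congrFun h i)
  simpa [Matrix.mulVec, dotProduct] using hi

lemma mem_harmonicSpace {α β : Type*} {G : Graph α β} [Fintype G.edgeSet] [Fintype G.vertexSet]
    (D : G.EdgeOrientation) {r : ℕ} (bd : Matrix G.edgeSet (Fin r) ℤ) {z : G.edgeSet → ℤ}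
    (h₁ : D.incidence.mulVec z = 0) (h₂ : bd.transpose.mulVec z = 0) :
    (fun e => ((z e : ℤ) : ℝ)) ∈ D.harmonicSpace bd := by
  have h₁' := map_intCast_mulVec_eq_zero h₁
  have h₂' := map_intCast_mulVec_eq_zero h₂
  rw [Matrix.transpose_map] at h₂'
  rw [harmonicSpace, LinearMap.mem_ker, Matrix.mulVecLin_apply]
  simp only [laplacian]
  rw [Matrix.add_mulVec, ← Matrix.mulVec_mulVec, ← Matrix.mulVec_mulVec, h₁', h₂']
  simp

end EdgeOrientation

end Graph

theorem theoremB {α β : Type*} (G : Graph α β) [Fintype G.vertexSet] [Fintype G.edgeSet]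
    (hG : G.IsConnectedGraph) (D : G.EdgeOrientation)
    {r : ℕ} (bd : Matrix G.edgeSet (Fin r) ℤ) (hbd : D.IsUnicyclizer bd)
    (b : Module.Basis (Fin (r + 1)) ℤ D.cycleSpace) (c : D.CycleChoice) :
    hbd.standardHarmonicCycle b c ≠ 0 ∧
    (fun e => (((hbd.standardHarmonicCycle b c : G.edgeSet → ℤ) e : ℤ) : ℝ)) ∈
      D.harmonicSpace bd ∧
    D.incidence.mulVec (hbd.standardHarmonicCycle b c : G.edgeSet → ℤ) = 0 ∧
    bd.transpose.mulVec (hbd.standardHarmonicCycle b c : G.edgeSet → ℤ) = 0 := by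
  classical
  have h₁ : D.incidence.mulVec (hbd.standardHarmonicCycle b c : G.edgeSet → ℤ) = 0 :=
    LinearMap.mem_ker.1 (hbd.standardHarmonicCycle b c).2
  have h₂ : bd.transpose.mulVec (hbd.standardHarmonicCycle b c : G.edgeSet → ℤ) = 0 := by
    ext j
    have h := hbd.sum_standardHarmonicCycle_mul b c (hbd.column j)
    rw [hbd.winding_column b j, mul_zero] at h
    rw [Pi.zero_apply, ← h]
    exact Finset.sum_congr rfl fun e _ => mul_comm _ _
  refine ⟨fun h0 => ?_, D.mem_harmonicSpace bd h₁ h₂, h₁, h₂⟩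
  obtain ⟨x, hx⟩ := hbd.exists_winding_ne_zero b
  -- Connectedness of `G` enters only here, to make the number of spanning trees positive.
  obtain ⟨T, hT⟩ := Graph.EdgeOrientation.exists_isSpanningTree (D := D) hG
  have h := hbd.sum_standardHarmonicCycle_mul b c x
  rw [h0] at h
  simp only [ZeroMemClass.coe_zero, Pi.zero_apply, zero_mul, Finset.sum_const_zero] at h
  refine mul_ne_zero (Nat.cast_ne_zero.2 (Finset.card_ne_zero.2 ⟨T, ?_⟩)) hx h.symm
  simpa using hT
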